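/- Let $C(x)=\tfrac12\log_2(1+x)$. The Y-channel consists of three users and a relay. Each user $j\in\{1,2,3\}$ has, for each other user $k$, a message $m_{jk}\in\{1,\dots,\lfloor 2^{nR_{jk}}\rfloor\}$ with $R_{jk}\ge 0$; the six messages are independent and uniformly distributed. The channel coefficients $h_1,h_2,h_3\in\mathbb R$ satisfy $h_1^2\ge h_2^2\ge h_3^2$. At times $i=1,\dots,n$ the relay receives $y_{ri}=h_1x_{1i}+h_2x_{2i}+h_3x_{3i}+z_{ri}$ and user $j$ receives $y_{ji}=h_jx_{ri}+z_{ji}$, where $x_{ji}$ and $x_{ri}$ are the symbols sent by user $j$ and by the relay and all noises $z_{ri},z_{ji}$ are independent $\mathcal N(0,1)$ variables, independent of the messages. The channel is restricted: the codeword $x_j^n$ of user $j$ is a function of its own two messages $m_{jk},m_{jl}$ only. The relay symbol $x_{ri}$ is a (measurable, possibly time-dependent) function of $y_{r1},\dots,y_{r,i-1}$, and user $j$ decodes $(m_{kj},m_{lj})$ by a measurable function of $(y_j^n,m_{jk},m_{jl})$. The inputs satisfy the average power constraints $\frac1n\sum_{i=1}^n\mathbb E[X_{ji}^2]\le P$ for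 each user $j$ and $\frac1n\sum_{i=1}^n\mathbb E[X_{ri}^2]\le P_r$ for the relay. A rate tuple $(R_{12},R_{13},R_{21},R_{23},R_{31},R_{32})\in\mathbb R_+^6$ is achievable if there are such codes, one for each block length $n$, for which the probability that some user decodes one of its two messages incorrectly tends to $0$ as $n\to\infty$. The sum-capacity $C_r$ is the supremum of $R_{12}+R_{13}+R_{21}+R_{23}+R_{31}+R_{32}$ over all achievable rate tuples. **Theorem.** If $P=P_r\ge 0$, then $$C_r\le 2\,C(h_2^2P+h_3^2P).$$ Moreover, this bound is at least as tight as the following bound for the Y-channel in which the users' symbols may also depend on previously received symbols: $$2\,C(h_2^2P+h_3^2P)\le C(h_2^2P+h_3^2P)+C\bigl(\min\{h_1^2P+h_3^2P,\ (|h_2|+|h_3|)^2P\}\bigr).$$ -/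

import Mathlib

open MeasureTheory ProbabilityTheory Filter Topology
open scoped NNReal

namespace YChannel

noncomputable section

/-- The Gaussian capacity function `C(x) = (1/2) log₂ (1 + x)`, in bits. -/
def gaussC (x : ℝ) : ℝ := (1 / 2) * Real.logb 2 (1 + x)

/-- The six ordered pairs `(j, k)` of distinct users, standing for "from user `j` to user `k`".
Users `1, 2, 3` are `0, 1, 2 : Fin 3`. -/
abbrev Link : Type := {p : Fin 3 × Fin 3 // p.1 ≠ p.2}

/-- A rate tuple: one nonnegative rate for every ordered pair of distinct users. -/
abbrev RateTuple : Type := Link → ℝ≥0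

/-- The sum rate `R_Σ`, the sum of the six rates. -/
def sumRate (R : RateTuple) : ℝ := ∑ p : Link, (R p : ℝ)

/-- The message set `{1, …, 2 ^ (n R_p)}`: as many messages as there are positive integers
not exceeding `2 ^ (n R_p)`. -/
abbrev Message (R : RateTuple) (n : ℕ) (p : Link) : Type :=
  Fin ⌊(2 : ℝ) ^ ((n : ℝ) * (R p : ℝ))⌋₊

/-- The vector of all six messages. -/
abbrev Messages (R : RateTuple) (n : ℕ) : Type := (p : Link) → Message R n p

/-- The two messages that user `j` sends. -/
abbrev OutMessages (R : RateTuple) (n : ℕ) (j : Fin 3) : Type :=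
  (p : {p : Link // p.1.1 = j}) → Message R n p.1

/-- The two messages that user `j` has to decode. -/
abbrev InMessages (R : RateTuple) (n : ℕ) (j : Fin 3) : Type :=
  (p : {p : Link // p.1.2 = j}) → Message R n p.1

/-- The messages of user `j` within the vector of all messages. -/
def outMessages {R : RateTuple} {n : ℕ} (m : Messages R n) (j : Fin 3) : OutMessages R n j :=
  fun p => m p.1

/-- The messages intended for user `j` within the vector of all messages. -/
def inMessages {R : RateTuple} {n : ℕ} (m : Messages R n) (j : Fin 3) : InMessages R n j :=
  fun p => m p.1

/-- A code with rate tuple `R` and block length `n` for the restricted Y-channel. The codeword of a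
user is a function of its own two messages only; the relay input at time `i` is a function of the
relay outputs at the times before `i`; user `j` decodes from its received word and its own two
messages. -/
structure Code (R : RateTuple) (n : ℕ) where
  enc : (j : Fin 3) → OutMessages R n j → Fin n → ℝ
  relay : (i : Fin n) → (Fin (i : ℕ) → ℝ) → ℝ
  measurable_relay : ∀ i, Measurable (relay i)
  dec : (j : Fin 3) → (Fin n → ℝ) → OutMessages R n j → InMessages R n j
  measurable_dec : ∀ (j : Fin 3) (m : OutMessages R n j), Measurable (fun y => dec j y m)

/-- Sample space: the messages, the noise at the relay, and the noises at the three users. -/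
abbrev Sample (R : RateTuple) (n : ℕ) : Type :=
  Messages R n × (Fin n → ℝ) × (Fin 3 → Fin n → ℝ)

/-- Law of messages and noises: the messages are independent and uniformly distributed, all noise
variables are independent standard Gaussians, and noises and messages are independent. -/
def law (R : RateTuple) (n : ℕ) : Measure (Sample R n) :=
  (uniformOn (Set.univ : Set (Messages R n))).prod
    ((Measure.pi fun _ : Fin n => gaussianReal 0 1).prod
      (Measure.pi fun _ : Fin 3 => Measure.pi fun _ : Fin n => gaussianReal 0 1))

namespace Code

variable {R : RateTuple} {n : ℕ}

/-- The symbol `x_{ji}` sent by user `j` at time `i`. -/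
def userInput (c : Code R n) (j : Fin 3) (i : Fin n) (ω : Sample R n) : ℝ :=
  c.enc j (outMessages ω.1 j) i

/-- The symbol `y_{ri} = h_1 x_{1i} + h_2 x_{2i} + h_3 x_{3i} + z_{ri}` received by the relay. -/
def relayOutput (c : Code R n) (h : Fin 3 → ℝ) (i : Fin n) (ω : Sample R n) : ℝ :=
  (∑ j : Fin 3, h j * c.userInput j i ω) + ω.2.1 i

/-- The symbol `x_{ri} = f_{r,i}(y_r^{i-1})` sent by the relay at time `i`. -/
def relayInput (c : Code R n) (h : Fin 3 → ℝ) (i : Fin n) (ω : Sample R n) : ℝ :=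
  c.relay i fun t => c.relayOutput h (Fin.castLE i.isLt.le t) ω

/-- The symbol `y_{ji} = h_j x_{ri} + z_{ji}` received by user `j` at time `i`. -/
def userOutput (c : Code R n) (h : Fin 3 → ℝ) (j : Fin 3) (i : Fin n) (ω : Sample R n) : ℝ :=
  h j * c.relayInput h i ω + ω.2.2 j i

/-- The average power constraints: `P` at each of the users and `Pr` at the relay. -/
def PowerConstraint (c : Code R n) (h : Fin 3 → ℝ) (P Pr : ℝ) : Prop :=
  (∀ j : Fin 3, (1 / (n : ℝ)) * ∑ i : Fin n, ∫ ω, c.userInput j i ω ^ 2 ∂(law R n) ≤ P) ∧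
  (∀ i : Fin n, Integrable (fun ω => c.relayInput h i ω ^ 2) (law R n)) ∧
  (1 / (n : ℝ)) * ∑ i : Fin n, ∫ ω, c.relayInput h i ω ^ 2 ∂(law R n) ≤ Pr

/-- The error event: some user decodes at least one of its two messages incorrectly. -/
def errorEvent (c : Code R n) (h : Fin 3 → ℝ) : Set (Sample R n) :=
  {ω | ∃ j : Fin 3,
    c.dec j (fun i => c.userOutput h j i ω) (outMessages ω.1 j) ≠ inMessages ω.1 j}

/-- The average error probability. -/
def errorProb (c : Code R n) (h : Fin 3 → ℝ) : ℝ := (law R n).real (c.errorEvent h)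

end Code

/-- A rate tuple is achievable if there is a sequence of codes, one for each block length, that
satisfy the power constraints and whose average error probability tends to zero. -/
def Achievable (h : Fin 3 → ℝ) (P Pr : ℝ) (R : RateTuple) : Prop :=
  ∃ c : (n : ℕ) → Code R n, (∀ n, (c n).PowerConstraint h P Pr) ∧
    Tendsto (fun n => (c n).errorProb h) atTop (𝓝 0)

/-- The capacity region of the restricted Y-channel. -/
def capacityRegion (h : Fin 3 → ℝ) (P Pr : ℝ) : Set RateTuple := {R | Achievable h P Pr R}

/-- The sum-capacity `C_r` of the restricted Y-channel, the supremum of the achievable sum rates,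
taken in the extended reals so that an unbounded set of rates has supremum `⊤`. -/
def sumCapacity (h : Fin 3 → ℝ) (P Pr : ℝ) : EReal :=
  ⨆ R ∈ capacityRegion h P Pr, ((sumRate R : ℝ) : EReal)

end

end YChannel

/-! Users are indexed 0, 1, 2 from strongest to weakest. The six messages split into three upward
ones (towards a larger index) and three downward ones, and each triple has sum rate at most `C(h₁²P
+ h₂²P)`, in the indexing of the code. Adding the two bounds gives the factor 2.

Downward messages (`Code.downLinks_bound`): a receiver is given the upward messages, the relay's
received word and the user noises. It knows everything user 0 sends, so it can imitate user 0's
decoder and then user 1's, which reveals all messages. After removing the contribution of user 0,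
the relay sees only users 1 and 2. Their codewords are independent because the channel is
restricted, so the signal variances add.

Upward messages (`Code.upLinks_bound`): a receiver is given the downward messages and the words
received by users 1 and 2. It imitates user 2's decoder and then user 1's. The relevant channel has
one input, the relay symbol, and two outputs, with signal-to-noise ratio `(h₁² + h₂²)Pr`.

Entropy and Fano's inequality are replaced by a change of measure. For every message vector, tilting
the noise by `exp (-ℓ)` makes the observation follow a fixed Gaussian law `Q` that does not depend
on the messages. Under `Q` the decoder can only guess, so the mean of `ℓ`, playing the role of
mutual information, bounds the log-number of recovered messages (`measureReal_mul_log_le`,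
`sum_measureReal_mul_log_le`, `Code.one_sub_errorProb_mul_log_le`). The power constraints bound that
mean through `integral_gaussLLR`. Dividing by `n` and letting `n → ∞` finishes the proof in
`Achievable.sumRate_le`. -/

namespace YChannel

/-! ### Gaussian change of measure and a Fano-type inequality -/

/-- The log-likelihood ratio of `N(a, 1)` against `N(0, v)` at the point `a + z`. -/
noncomputable def gaussLLR (v a z : ℝ) : ℝ :=
  (1 / 2) * Real.log v - z ^ 2 / 2 + (a + z) ^ 2 / (2 * v)

theorem measurable_gaussLLR (v a : ℝ) : Measurable (gaussLLR v a) := by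
  unfold gaussLLR; fun_prop

theorem exp_neg_gaussLLR_mul_gaussianPDFReal {v : ℝ≥0} (hv : v ≠ 0) (a z : ℝ) :
    gaussianPDFReal 0 1 z * Real.exp (-gaussLLR v a z) = gaussianPDFReal 0 v (a + z) := by
  have hv' : (0 : ℝ) < v := by positivity
  have hs : Real.exp (-((1 / 2) * Real.log v)) = (√(v : ℝ))⁻¹ := by
    rw [Real.exp_neg, Real.sqrt_eq_rpow, Real.rpow_def_of_pos hv']
    ring_nf
  have he : -gaussLLR v a z
      = -((1 / 2) * Real.log v) + (z ^ 2 / 2 + -((a + z) ^ 2 / (2 * v))) := by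
    unfold gaussLLR; ring
  have hsq : √(2 * Real.pi * (v : ℝ)) = √(2 * Real.pi) * √(v : ℝ) :=
    Real.sqrt_mul (by positivity) _
  rw [gaussianPDFReal, gaussianPDFReal, he, Real.exp_add, hs, hsq, Real.exp_add]
  have h1 : Real.exp (-(z - 0) ^ 2 / (2 * ((1 : ℝ≥0) : ℝ))) * Real.exp (z ^ 2 / 2) = 1 := by
    rw [← Real.exp_add]; simp; ring
  have h2 : -(a + z - 0) ^ 2 / (2 * (v : ℝ)) = -((a + z) ^ 2 / (2 * v)) := by ring
  rw [h2]
  simp only [NNReal.coe_one, mul_one, mul_inv] at h1 ⊢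
  linear_combination ((√(2 * Real.pi))⁻¹ * (√(v : ℝ))⁻¹ * Real.exp (-((a + z) ^ 2 / (2 * v)))) * h1

theorem lintegral_gaussLLR {v : ℝ≥0} (hv : v ≠ 0) (a : ℝ) {g : ℝ → ENNReal} (hg : Measurable g) :
    ∫⁻ z, g (a + z) * ENNReal.ofReal (Real.exp (-gaussLLR v a z)) ∂gaussianReal 0 1
      = ∫⁻ y, g y ∂gaussianReal 0 v := by
  have hm := measurable_gaussLLR v a
  rw [gaussianReal_of_var_ne_zero _ hv, gaussianReal_of_var_ne_zero _ one_ne_zero,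
    lintegral_withDensity_eq_lintegral_mul _ (measurable_gaussianPDF _ _) (by fun_prop),
    lintegral_withDensity_eq_lintegral_mul _ (measurable_gaussianPDF _ _) hg,
    ← lintegral_add_left_eq_self (μ := volume) (gaussianPDF 0 v * g) a]
  refine lintegral_congr fun z => ?_
  simp only [Pi.mul_apply, gaussianPDF]
  rw [← exp_neg_gaussLLR_mul_gaussianPDFReal hv,
    ENNReal.ofReal_mul (gaussianPDFReal_nonneg _ _ _)]
  ring

/-- The law of a vector of independent centred Gaussians of variance `v`. -/
noncomputable abbrev gaussVec (n : ℕ) (v : ℝ≥0) : Measure (Fin n → ℝ) :=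
  Measure.pi fun _ => gaussianReal 0 v

theorem lintegral_gaussVec_prod {n : ℕ} {v : ℝ≥0} {f : Fin n → ℝ → ENNReal}
    (hf : ∀ i, Measurable (f i)) :
    ∫⁻ z, ∏ i, f i (z i) ∂gaussVec n v = ∏ i, ∫⁻ x, f i x ∂gaussianReal 0 v := by
  have hind : iIndepFun (fun i (z : Fin n → ℝ) => f i (z i)) (gaussVec n v) :=
    iIndepFun_pi (μ := fun _ : Fin n => gaussianReal 0 v) fun i => (hf i).aemeasurable
  rw [lintegral_prod_eq_prod_lintegral_of_indepFun Finset.univ _ hind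
    fun i => (hf i).comp (measurable_pi_apply i)]
  refine Finset.prod_congr rfl fun i _ => ?_
  exact (measurePreserving_eval (fun _ : Fin n => gaussianReal 0 v) i).lintegral_comp (hf i)

/-- The right-hand side does not involve the shift `a`: this makes the reference law common to all
message vectors. The weight is a product over coordinates, so comparing measures on boxes reduces
the claim to dimension one. -/
theorem lintegral_gaussVec_gaussLLR {n : ℕ} {v : ℝ≥0} (hv : v ≠ 0) (a : Fin n → ℝ)
    {g : (Fin n → ℝ) → ENNReal} (hg : Measurable g) :
    ∫⁻ z, g (a + z) * ENNReal.ofReal (Real.exp (-∑ i, gaussLLR v (a i) (z i))) ∂gaussVec n 1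
      = ∫⁻ y, g y ∂gaussVec n v := by
  have hm := fun i => measurable_gaussLLR v (a i)
  set d : (Fin n → ℝ) → ENNReal :=
    fun z => ENNReal.ofReal (Real.exp (-∑ i, gaussLLR v (a i) (z i))) with hd
  have hdm : Measurable d := by fun_prop
  have hprod : ∀ z, d z = ∏ i, ENNReal.ofReal (Real.exp (-gaussLLR v (a i) (z i))) := by
    intro z
    rw [← ENNReal.ofReal_prod_of_nonneg fun i _ => (Real.exp_pos _).le, ← Real.exp_sum,
      Finset.sum_neg_distrib]
  have hmap : gaussVec n v = ((gaussVec n 1).withDensity d).map (a + ·) := by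
    refine Measure.pi_eq fun s hs => ?_
    have hbox : MeasurableSet (Set.univ.pi s) := MeasurableSet.univ_pi hs
    rw [Measure.map_apply (by fun_prop) hbox, withDensity_apply _ (by measurability),
      ← lintegral_indicator (by measurability)]
    have key : ∀ z, ((a + ·) ⁻¹' Set.univ.pi s).indicator d z
        = ∏ i, ((s i).indicator 1 (a i + z i)
            * ENNReal.ofReal (Real.exp (-gaussLLR v (a i) (z i)))) := by
      intro z
      rw [Finset.prod_mul_distrib, ← hprod]
      by_cases hz : z ∈ (a + ·) ⁻¹' Set.univ.pi s
      · rw [Set.indicator_of_mem hz, Finset.prod_eq_one, one_mul]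
        intro i _
        exact Set.indicator_of_mem (hz i trivial) _
      · rw [Set.indicator_of_notMem hz]
        obtain ⟨i, hi⟩ : ∃ i, a i + z i ∉ s i := by
          by_contra! hcon
          exact hz fun i _ => hcon i
        rw [Finset.prod_eq_zero (Finset.mem_univ i) (Set.indicator_of_notMem hi _), zero_mul]
    simp_rw [key]
    have hmi : ∀ i, Measurable fun x : ℝ => (s i).indicator (1 : ℝ → ENNReal) (a i + x)
        * ENNReal.ofReal (Real.exp (-gaussLLR v (a i) x)) := by
      intro i
      have := (measurable_one (α := ENNReal) (β := ℝ)).indicator (hs i)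
      fun_prop
    rw [lintegral_gaussVec_prod hmi]
    refine Finset.prod_congr rfl fun i _ => ?_
    rw [lintegral_gaussLLR hv (a i) ((measurable_one).indicator (hs i)),
      lintegral_indicator_one (hs i)]
  rw [hmap, lintegral_map hg (by fun_prop),
    lintegral_withDensity_eq_lintegral_mul _ hdm (by fun_prop)]
  exact lintegral_congr fun z => mul_comm _ _

/-- The cost of guessing: `P(S) log r` is at most the mean log-likelihood ratio plus `r` times the
probability of `S` under the reference measure. -/
theorem measureReal_mul_log_le {Z : Type*} [MeasurableSpace Z] (ζ : Measure Z)
    [IsProbabilityMeasure ζ] {ℓ : Z → ℝ} (hℓ : Integrable ℓ ζ) (hℓm : Measurable ℓ) {S : Set Z}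
    (hS : MeasurableSet S) {r : ℝ} (hr : 0 < r) {q : ℝ} (hq : 0 ≤ q)
    (h1 : ∫⁻ z, ENNReal.ofReal (Real.exp (-ℓ z)) ∂ζ = 1)
    (h2 : ∫⁻ z in S, ENNReal.ofReal (Real.exp (-ℓ z)) ∂ζ = ENNReal.ofReal q) :
    ζ.real S * Real.log r ≤ ∫ z, ℓ z ∂ζ + r * q := by
  have hm : Measurable fun z => Real.exp (-ℓ z) := by fun_prop
  have hi : Integrable (fun z => Real.exp (-ℓ z)) ζ := by
    refine ⟨hm.aestronglyMeasurable, ?_⟩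
    rw [hasFiniteIntegral_iff_ofReal (ae_of_all _ fun z => (Real.exp_pos _).le), h1]
    exact ENNReal.one_lt_top
  have e1 : ∫ z, Real.exp (-ℓ z) ∂ζ = 1 := by
    rw [integral_eq_lintegral_of_nonneg_ae (ae_of_all _ fun z => (Real.exp_pos _).le)
      hm.aestronglyMeasurable, h1, ENNReal.toReal_one]
  have e2 : ∫ z in S, Real.exp (-ℓ z) ∂ζ = q := by
    rw [integral_eq_lintegral_of_nonneg_ae (ae_of_all _ fun z => (Real.exp_pos _).le)
      hm.aestronglyMeasurable, h2, ENNReal.toReal_ofReal hq]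
  have hir := (hi.indicator hS).const_mul r
  have hsum : Integrable (fun z => Real.exp (-ℓ z)
      + r * S.indicator (fun z => Real.exp (-ℓ z)) z) ζ := hi.add hir
  have e3 : ∫ z, (Real.exp (-ℓ z) + r * S.indicator (fun z => Real.exp (-ℓ z)) z - 1) ∂ζ
      = 1 + r * q - 1 := by
    rw [integral_sub hsum (integrable_const _),
      integral_add hi hir, integral_const_mul, integral_indicator hS, e1, e2]
    simp
  -- Pointwise this is `t + 1 ≤ exp t`, with `t = log r - ℓ` on `S` and `t = -ℓ` off `S`; on `S` the
  -- spare term `exp (-ℓ)` on the right is merely nonnegative.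
  have hle : ∫ z, (S.indicator (fun _ => Real.log r) z - ℓ z) ∂ζ
      ≤ ∫ z, (Real.exp (-ℓ z) + r * S.indicator (fun z => Real.exp (-ℓ z)) z - 1) ∂ζ := by
    refine integral_mono (((integrable_const _).indicator hS).sub hℓ)
      (hsum.sub (integrable_const _)) fun z => ?_
    by_cases hz : z ∈ S
    · simp only [Set.indicator_of_mem hz]
      have := Real.add_one_le_exp (Real.log r - ℓ z)
      rw [sub_eq_add_neg (Real.log r), Real.exp_add, Real.exp_log hr] at this
      linarith [Real.exp_pos (-ℓ z)]
    · simp only [Set.indicator_of_notMem hz]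
      linarith [Real.add_one_le_exp (-ℓ z)]
  rw [integral_sub ((integrable_const _).indicator hS) hℓ, integral_indicator_const _ hS,
    e3, smul_eq_mul] at hle
  linarith

/-- A Fano-type bound for list decoding with lists of size at most `K`. -/
theorem sum_measureReal_mul_log_le {M Z V : Type*} [Fintype M] [MeasurableSpace Z]
    [MeasurableSpace V] (ζ : Measure Z) [IsProbabilityMeasure ζ] (Q : Measure V)
    [IsProbabilityMeasure Q] {v : M → Z → V} (hv : ∀ m, Measurable (v m)) {ℓ : M → Z → ℝ}
    (hℓ : ∀ m, Integrable (ℓ m) ζ) (hℓm : ∀ m, Measurable (ℓ m))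
    (hQ : ∀ m, ∀ g : V → ENNReal, Measurable g →
      ∫⁻ z, g (v m z) * ENNReal.ofReal (Real.exp (-ℓ m z)) ∂ζ = ∫⁻ y, g y ∂Q)
    {G : V → Set M} (hG : ∀ m, MeasurableSet {y | m ∈ G y}) {K : ℝ}
    (hK : ∀ y, ((G y).ncard : ℝ) ≤ K) {r : ℝ} (hr : 0 < r) :
    (∑ m, ζ.real {z | m ∈ G (v m z)}) * Real.log r ≤ ∑ m, ∫ z, ℓ m z ∂ζ + r * K := by
  have hstep : ∀ m, ζ.real {z | m ∈ G (v m z)} * Real.log r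
      ≤ ∫ z, ℓ m z ∂ζ + r * Q.real {y | m ∈ G y} := by
    intro m
    have hS : MeasurableSet {z | m ∈ G (v m z)} := hv m (hG m)
    refine measureReal_mul_log_le ζ (hℓ m) (hℓm m) hS hr measureReal_nonneg ?_ ?_
    · simpa using hQ m 1 measurable_one
    · have := hQ m ({y | m ∈ G y}.indicator 1) (measurable_one.indicator (hG m))
      rw [lintegral_indicator_one (hG m)] at this
      rw [ofReal_measureReal, ← this, ← lintegral_indicator hS]
      refine lintegral_congr fun z => ?_
      by_cases hz : m ∈ G (v m z)
      · simp [Set.indicator, hz]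
      · simp [Set.indicator, hz]
  -- Since `Q` is the same for all `m`, exchanging sum and integral turns this into the mean list
  -- size.
  have hcard : ∑ m, Q.real {y | m ∈ G y} ≤ K := by
    have e : ∀ m, Q.real {y | m ∈ G y} = ∫ y, {y | m ∈ G y}.indicator (fun _ => (1 : ℝ)) y ∂Q := by
      intro m
      rw [integral_indicator_const _ (hG m), smul_eq_mul, mul_one]
    simp_rw [e]
    have hi : ∀ m, Integrable ({y | m ∈ G y}.indicator (fun _ => (1 : ℝ))) Q :=
      fun m => (integrable_const _).indicator (hG m)
    rw [← integral_finsetSum _ fun m _ => hi m]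
    calc ∫ y, ∑ m, {y | m ∈ G y}.indicator (fun _ => (1 : ℝ)) y ∂Q
        ≤ ∫ _, K ∂Q := by
          refine integral_mono (integrable_finsetSum _ fun m _ => hi m) (integrable_const _)
            fun y => ?_
          classical
          refine le_trans (le_of_eq ?_) (hK y)
          rw [Set.ncard_eq_toFinset_card']
          simp [Set.indicator, Set.toFinset]
      _ = K := by simp
  rw [Finset.sum_mul]
  refine (Finset.sum_le_sum fun m _ => hstep m).trans ?_
  rw [Finset.sum_add_distrib, ← Finset.mul_sum]
  gcongr

end YChannel

/-! ### Mean log-likelihood ratios and moments of the noise -/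

namespace YChannel

theorem integrable_gaussLLR {Ω : Type*} [MeasurableSpace Ω] {μ : Measure Ω}
    [IsProbabilityMeasure μ] (v : ℝ) {A Z : Ω → ℝ} (hA : MemLp A 2 μ) (hZ : MemLp Z 2 μ) :
    Integrable (fun ω => gaussLLR v (A ω) (Z ω)) μ := by
  unfold gaussLLR
  exact ((integrable_const _).sub (hZ.integrable_sq.div_const 2)).add
    ((hA.add hZ).integrable_sq.div_const _)

/-- Orthogonality of signal and noise suffices, so `A` may itself contain noise from elsewhere. For
signal energy `v - 1` the last two terms cancel and the value is `(1/2) log v`, the capacity in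
nats. -/
theorem integral_gaussLLR {Ω : Type*} [MeasurableSpace Ω] {μ : Measure Ω}
    [IsProbabilityMeasure μ] (v : ℝ) {A Z : Ω → ℝ} (hA : MemLp A 2 μ) (hZ : MemLp Z 2 μ)
    (hAZ : ∫ ω, A ω * Z ω ∂μ = 0) (hZ2 : ∫ ω, Z ω ^ 2 ∂μ = 1) :
    ∫ ω, gaussLLR v (A ω) (Z ω) ∂μ
      = (1 / 2) * Real.log v - 1 / 2 + (∫ ω, A ω ^ 2 ∂μ + 1) / (2 * v) := by
  have hm : Integrable (fun ω => A ω * Z ω) μ := hA.integrable_mul hZ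
  have e : ∀ ω, gaussLLR v (A ω) (Z ω) = (1 / 2) * Real.log v
      + ((1 / (2 * v) - 1 / 2) * Z ω ^ 2 + ((1 / (2 * v)) * A ω ^ 2 + (1 / v) * (A ω * Z ω))) := by
    intro ω; unfold gaussLLR; rcases eq_or_ne v 0 with rfl | hv
    · simp; ring
    · field_simp; ring
  simp_rw [e]
  have i1 := hZ.integrable_sq.const_mul (1 / (2 * v) - 1 / 2)
  have i2 := hA.integrable_sq.const_mul (1 / (2 * v))
  have i3 := hm.const_mul (1 / v)
  have i23 : Integrable (fun ω => (1 / (2 * v)) * A ω ^ 2 + (1 / v) * (A ω * Z ω)) μ := i2.add i3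
  have i123 : Integrable (fun ω => (1 / (2 * v) - 1 / 2) * Z ω ^ 2
    + ((1 / (2 * v)) * A ω ^ 2 + (1 / v) * (A ω * Z ω))) μ := i1.add i23
  rw [integral_add (integrable_const _) i123, integral_add i1 i23, integral_add i2 i3,
    integral_const_mul, integral_const_mul, integral_const_mul, integral_const_mul, hAZ, hZ2]
  simp
  ring

/-- The joint law of the relay noise and the three user noises. -/
noncomputable abbrev noiseLaw (n : ℕ) : Measure ((Fin n → ℝ) × (Fin 3 → Fin n → ℝ)) :=
  (gaussVec n 1).prod (Measure.pi fun _ : Fin 3 => gaussVec n 1)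

theorem measurePreserving_relayNoise {n : ℕ} (i : Fin n) :
    MeasurePreserving (fun z : (Fin n → ℝ) × (Fin 3 → Fin n → ℝ) => z.1 i) (noiseLaw n)
      (gaussianReal 0 1) :=
  (measurePreserving_eval (fun _ : Fin n => gaussianReal 0 1) i).comp measurePreserving_fst

theorem measurePreserving_userNoise {n : ℕ} (j : Fin 3) (i : Fin n) :
    MeasurePreserving (fun z : (Fin n → ℝ) × (Fin 3 → Fin n → ℝ) => z.2 j i) (noiseLaw n)
      (gaussianReal 0 1) :=
  (measurePreserving_eval (fun _ : Fin n => gaussianReal 0 1) i).comp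
    ((measurePreserving_eval (fun _ : Fin 3 => gaussVec n 1) j).comp measurePreserving_snd)

section StandardGaussian

variable {Ω : Type*} [MeasurableSpace Ω] {μ : Measure Ω} {Z : Ω → ℝ}

theorem memLp_two_of_measurePreserving (hZ : MeasurePreserving Z μ (gaussianReal 0 1)) :
    MemLp Z 2 μ :=
  (memLp_id_gaussianReal (μ := 0) (v := 1) 2).comp_measurePreserving hZ

theorem integral_of_measurePreserving (hZ : MeasurePreserving Z μ (gaussianReal 0 1)) :
    ∫ ω, Z ω ∂μ = 0 := by
  have := integral_map (μ := μ) (φ := Z) (f := fun x : ℝ => x) hZ.measurable.aemeasurable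
    measurable_id.aestronglyMeasurable
  rw [← this, hZ.map_eq, integral_id_gaussianReal]

theorem integral_sq_of_measurePreserving (hZ : MeasurePreserving Z μ (gaussianReal 0 1)) :
    ∫ ω, Z ω ^ 2 ∂μ = 1 := by
  have := integral_map (μ := μ) (φ := Z) (f := fun x : ℝ => x ^ 2) hZ.measurable.aemeasurable
    (by fun_prop)
  rw [← this, hZ.map_eq]
  have hv := variance_fun_id_gaussianReal (μ := 0) (v := 1)
  rw [variance_eq_integral (by fun_prop), integral_id_gaussianReal] at hv
  simpa using hv

end StandardGaussian

theorem integral_userNoise_mul_userNoise {n : ℕ} {j k : Fin 3} (hjk : j ≠ k) (i : Fin n) :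
    ∫ z, z.2 j i * z.2 k i ∂noiseLaw n = 0 := by
  have hind : iIndepFun (fun (j : Fin 3) (z : Fin 3 → Fin n → ℝ) => z j i)
      (Measure.pi fun _ : Fin 3 => gaussVec n 1) :=
    iIndepFun_pi (μ := fun _ : Fin 3 => gaussVec n 1) (X := fun _ x => x i)
      fun _ => (measurable_pi_apply i).aemeasurable
  have h0 : ∫ z, z j i ∂(Measure.pi fun _ : Fin 3 => gaussVec n 1) = 0 :=
    integral_of_measurePreserving
      ((measurePreserving_eval (fun _ : Fin n => gaussianReal 0 1) i).comp
        (measurePreserving_eval (fun _ : Fin 3 => gaussVec n 1) j))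
  have hm : ∀ j : Fin 3, Measurable fun z : Fin 3 → Fin n → ℝ => z j i := fun j => by fun_prop
  have h1 := (hind.indepFun hjk).integral_fun_mul_eq_mul_integral
    (hm j).aestronglyMeasurable (hm k).aestronglyMeasurable
  rw [h0, zero_mul] at h1
  have := integral_prod_mul (μ := gaussVec n 1) (ν := Measure.pi fun _ : Fin 3 => gaussVec n 1)
    (fun _ => (1 : ℝ)) (fun z => z j i * z k i)
  rw [h1, mul_zero] at this
  simpa using this

theorem integral_relay_mul_userNoise {n : ℕ} (f : (Fin n → ℝ) → ℝ) (j : Fin 3) (i : Fin n) :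
    ∫ z, f z.1 * z.2 j i ∂noiseLaw n = 0 := by
  have h0 : ∫ z, z j i ∂(Measure.pi fun _ : Fin 3 => gaussVec n 1) = 0 :=
    integral_of_measurePreserving
      ((measurePreserving_eval (fun _ : Fin n => gaussianReal 0 1) i).comp
        (measurePreserving_eval (fun _ : Fin 3 => gaussVec n 1) j))
  rw [integral_prod_mul f (fun z : Fin 3 → Fin n → ℝ => z j i), h0, mul_zero]

/-- The noises of the second and third users are independent and standard Gaussian. -/
theorem lintegral_noiseLaw_two_users {n : ℕ}
    {f : (Fin n → ℝ) → (Fin n → ℝ) → (Fin n → ℝ) → ENNReal}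
    (hf : Measurable fun z : (Fin n → ℝ) × (Fin n → ℝ) × (Fin n → ℝ) => f z.1 z.2.1 z.2.2) :
    ∫⁻ z, f z.1 (z.2 1) (z.2 2) ∂noiseLaw n
      = ∫⁻ x, ∫⁻ z₁, ∫⁻ z₂, f x z₁ z₂ ∂gaussVec n 1 ∂gaussVec n 1 ∂gaussVec n 1 := by
  rw [lintegral_prod _ (by
    have : Measurable fun z : (Fin n → ℝ) × (Fin 3 → Fin n → ℝ) => (z.1, z.2 1, z.2 2) := by
      fun_prop
    exact (hf.comp this).aemeasurable)]
  refine lintegral_congr fun x => ?_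
  have hfx : Measurable fun z : (Fin n → ℝ) × (Fin n → ℝ) => f x z.1 z.2 := by
    have : Measurable fun z : (Fin n → ℝ) × (Fin n → ℝ) => (x, z.1, z.2) := by fun_prop
    exact hf.comp this
  have hmp : MeasurePreserving (fun z : Fin 3 → Fin n → ℝ => (z 1, z 2))
      (Measure.pi fun _ : Fin 3 => gaussVec n 1) ((gaussVec n 1).prod (gaussVec n 1)) :=
    (measurePreserving_finTwoArrow (gaussVec n 1)).comp
      (measurePreserving_snd.comp
        (measurePreserving_piFinSuccAbove (fun _ : Fin 3 => gaussVec n 1) 0))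
  have := hmp.lintegral_comp hfx
  simp only at this
  rw [this, lintegral_prod _ hfx.aemeasurable]

/-! ### Averaging over uniform messages -/

section Law

variable {R : RateTuple} {n : ℕ}

theorem one_le_two_rpow (R : RateTuple) (n : ℕ) (p : Link) :
    (1 : ℝ) ≤ (2 : ℝ) ^ ((n : ℝ) * (R p : ℝ)) :=
  Real.one_le_rpow (by norm_num) (by positivity)

instance (R : RateTuple) (n : ℕ) (p : Link) : Nonempty (Message R n p) :=
  Fin.pos_iff_nonempty.1 (Nat.floor_pos.2 (one_le_two_rpow R n p))

theorem uniformOn_real_singleton (m : Messages R n) :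
    (uniformOn (Set.univ : Set (Messages R n))).real {m} = 1 / Fintype.card (Messages R n) := by
  rw [Measure.real, uniformOn_univ]
  simp

instance : IsProbabilityMeasure (uniformOn (Set.univ : Set (Messages R n))) :=
  isProbabilityMeasure_uniformOn Set.finite_univ Set.univ_nonempty

instance : IsProbabilityMeasure (law R n) := by unfold law; infer_instance

/-- Almost every section is integrable, and every message vector has positive mass, so no section is
exceptional. -/
theorem integrable_law_section {f : Sample R n → ℝ} (hf : Integrable f (law R n))
    (m : Messages R n) : Integrable (fun z => f (m, z)) (noiseLaw n) := by
  have h := hf.prod_right_ae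
  rw [ae_iff] at h
  by_contra hcon
  have h2 : uniformOn (Set.univ : Set (Messages R n)) {m} = 0 := measure_mono_null (by
    rintro _ rfl; exact hcon) h
  have h3 := uniformOn_real_singleton m
  rw [Measure.real, h2, ENNReal.toReal_zero] at h3
  have : (0 : ℝ) < 1 / Fintype.card (Messages R n) := by positivity
  exact this.ne h3

theorem integral_law {f : Sample R n → ℝ} (hf : Integrable f (law R n)) :
    ∫ ω, f ω ∂law R n
      = (1 / Fintype.card (Messages R n)) * ∑ m, ∫ z, f (m, z) ∂noiseLaw n := by
  rw [law, integral_prod _ hf, integral_fintype Integrable.of_finite, Finset.mul_sum]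
  simp_rw [uniformOn_real_singleton, smul_eq_mul]

theorem measurableSet_sample {E : Set (Sample R n)}
    (hE : ∀ m, MeasurableSet {z | (m, z) ∈ E}) : MeasurableSet E := by
  have : E = ⋃ m : Messages R n, {m} ×ˢ {z | (m, z) ∈ E} := by
    ext ⟨m, z⟩; simp
  rw [this]
  exact MeasurableSet.iUnion fun m => (measurableSet_singleton m).prod (hE m)

theorem law_real {E : Set (Sample R n)} (hE : ∀ m, MeasurableSet {z | (m, z) ∈ E}) :
    (law R n).real E
      = (1 / Fintype.card (Messages R n)) * ∑ m, (noiseLaw n).real {z | (m, z) ∈ E} := by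
  have hE' := measurableSet_sample hE
  have h := integral_law ((integrable_const (1 : ℝ)).indicator hE' (μ := law R n))
  rw [integral_indicator_const _ hE', smul_eq_mul, mul_one] at h
  rw [h]
  congr 1
  refine Finset.sum_congr rfl fun m _ => ?_
  have : (fun z => E.indicator (fun _ => (1 : ℝ)) (m, z))
      = {z | (m, z) ∈ E}.indicator fun _ => 1 := by
    ext z; simp [Set.indicator]
  rw [this, integral_indicator_const _ (hE m), smul_eq_mul, mul_one]

/-- Functions of the messages of two distinct users are uncorrelated. -/
theorem card_mul_sum_mul {j k : Fin 3} (hjk : j ≠ k) (f : OutMessages R n j → ℝ)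
    (g : OutMessages R n k → ℝ) :
    (Fintype.card (Messages R n) : ℝ) * ∑ m : Messages R n, f (outMessages m j) * g (outMessages m k)
      = (∑ m : Messages R n, f (outMessages m j)) * ∑ m : Messages R n, g (outMessages m k) := by
  -- Independence by exchange: `φ` keeps the messages of user `j` in two independent copies and
  -- swaps all the others. This involution turns the double sum of `f(m) g(m')` into that of `f(m)
  -- g(m)`.
  let mix : Messages R n → Messages R n → Messages R n :=
    fun m m' p => if p.1.1 = j then m p else m' p
  let φ : Messages R n × Messages R n → Messages R n × Messages R n :=
    fun x => (mix x.1 x.2, mix x.2 x.1)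
  have hφ : Function.Involutive φ := by
    rintro ⟨m, m'⟩
    refine Prod.ext (funext fun p => ?_) (funext fun p => ?_) <;>
    · by_cases hp : p.1.1 = j <;> simp [φ, mix, hp]
  rw [Finset.sum_mul_sum, ← Fintype.sum_prod_type', ← Equiv.sum_comp (hφ.toPerm φ)]
  have key : ∀ x : Messages R n × Messages R n,
      f (outMessages (φ x).1 j) * g (outMessages (φ x).2 k)
        = f (outMessages x.1 j) * g (outMessages x.1 k) := by
    rintro ⟨m, m'⟩
    congr 2
    · funext p
      simp [outMessages, φ, mix, p.2]
    · funext p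
      have : p.1.1.1 ≠ j := by rw [p.2]; exact hjk.symm
      simp [outMessages, φ, mix, this]
  simp_rw [Function.Involutive.coe_toPerm, key, Fintype.sum_prod_type, Finset.sum_const]
  rw [Finset.mul_sum]
  simp

/-- With `A` the messages handed to the genie receiver, a list whose members are determined by their
`A`-part is no longer than the number of possible `A`-parts. -/
theorem ncard_le_prod {A : Finset Link} {G : Set (Messages R n)}
    (hG : ∀ m ∈ G, ∀ m' ∈ G, (∀ p ∈ A, m p = m' p) → m = m') :
    (G.ncard : ℝ) ≤ ∏ p ∈ A, (Fintype.card (Message R n p) : ℝ) := by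
  have hinj : Set.InjOn (fun (m : Messages R n) (p : A) => m p.1) G := by
    intro m hm m' hm' h
    exact hG m hm m' hm' fun p hp => congrFun h ⟨p, hp⟩
  have h1 := Set.ncard_le_card ((fun (m : Messages R n) (p : A) => m p.1) '' G)
  rw [hinj.ncard_image, Nat.card_eq_fintype_card, Fintype.card_pi,
    Finset.prod_coe_sort A fun p => Fintype.card (Message R n p)] at h1
  exact_mod_cast h1

end Law

end YChannel

/-! ### Splitting the links, and the converse for a single code -/

namespace YChannel

/-- The links from a user to a user with a larger index. -/
def upLinks : Finset Link := Finset.univ.filter fun p => p.1.1 < p.1.2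

/-- The links from a user to a user with a smaller index. -/
def downLinks : Finset Link := Finset.univ.filter fun p => p.1.2 < p.1.1

theorem prod_upLinks_mul_prod_downLinks (f : Link → ℝ) :
    (∏ p ∈ upLinks, f p) * ∏ p ∈ downLinks, f p = ∏ p, f p := by
  have : downLinks = Finset.univ.filter fun p : Link => ¬ p.1.1 < p.1.2 := by
    ext p
    have := p.2
    simp only [downLinks, Finset.mem_filter, Finset.mem_univ, true_and]
    omega
  rw [this, upLinks, Finset.prod_filter_mul_prod_filter_not]

theorem sum_upLinks_add_sum_downLinks (f : Link → ℝ) :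
    (∑ p ∈ upLinks, f p) + ∑ p ∈ downLinks, f p = ∑ p, f p := by
  have : downLinks = Finset.univ.filter fun p : Link => ¬ p.1.1 < p.1.2 := by
    ext p
    have := p.2
    simp only [downLinks, Finset.mem_filter, Finset.mem_univ, true_and]
    omega
  rw [this, upLinks, Finset.sum_filter_add_sum_filter_not]

variable {R : RateTuple} {n : ℕ}

theorem messages_ext {m m' : Messages R n} (h01 : m ⟨(0, 1), by decide⟩ = m' ⟨(0, 1), by decide⟩)
    (h02 : m ⟨(0, 2), by decide⟩ = m' ⟨(0, 2), by decide⟩)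
    (h10 : m ⟨(1, 0), by decide⟩ = m' ⟨(1, 0), by decide⟩)
    (h12 : m ⟨(1, 2), by decide⟩ = m' ⟨(1, 2), by decide⟩)
    (h20 : m ⟨(2, 0), by decide⟩ = m' ⟨(2, 0), by decide⟩)
    (h21 : m ⟨(2, 1), by decide⟩ = m' ⟨(2, 1), by decide⟩) : m = m' := by
  funext ⟨⟨j, k⟩, hjk⟩
  fin_cases j <;> fin_cases k <;> first | exact absurd rfl hjk | assumption

theorem outMessages_congr {m m' : Messages R n} {j : Fin 3}
    (h : ∀ (k : Fin 3) (hk : j ≠ k), m ⟨(j, k), hk⟩ = m' ⟨(j, k), hk⟩) :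
    outMessages m j = outMessages m' j := by
  funext ⟨⟨⟨j', k⟩, hk⟩, hj⟩
  obtain rfl : j' = j := hj
  exact h k hk

theorem inMessages_eq {m m' : Messages R n} {k : Fin 3} (h : inMessages m k = inMessages m' k)
    (j : Fin 3) (hj : j ≠ k) : m ⟨(j, k), hj⟩ = m' ⟨(j, k), hj⟩ :=
  congrFun h ⟨⟨(j, k), hj⟩, rfl⟩

theorem measurableSet_dec_eq (c : Code R n) {V : Type*} [MeasurableSpace V] {y : V → Fin n → ℝ}
    (hy : Measurable y) (j : Fin 3) (o : OutMessages R n j) (q : InMessages R n j) :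
    MeasurableSet {v | c.dec j (y v) o = q} :=
  ((c.measurable_dec j o).comp hy) (measurableSet_singleton q)

namespace Code

theorem measurable_relayOutput (c : Code R n) (h : Fin 3 → ℝ) (i : Fin n) (m : Messages R n) :
    Measurable fun z => c.relayOutput h i (m, z) := by
  unfold relayOutput userInput
  fun_prop

theorem measurable_relayInput (c : Code R n) (h : Fin 3 → ℝ) (i : Fin n) (m : Messages R n) :
    Measurable fun z => c.relayInput h i (m, z) :=
  (c.measurable_relay i).comp
    (measurable_pi_lambda _ fun _ => c.measurable_relayOutput h _ m)

theorem measurable_userOutput (c : Code R n) (h : Fin 3 → ℝ) (j : Fin 3) (i : Fin n)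
    (m : Messages R n) : Measurable fun z => c.userOutput h j i (m, z) := by
  have := c.measurable_relayInput h i m
  unfold userOutput
  fun_prop

theorem measurableSet_errorEvent (c : Code R n) (h : Fin 3 → ℝ) (m : Messages R n) :
    MeasurableSet {z | (m, z) ∈ c.errorEvent h} := by
  have : {z | (m, z) ∈ c.errorEvent h} = ⋃ j : Fin 3,
      {z | c.dec j (fun i => c.userOutput h j i (m, z)) (outMessages m j) = inMessages m j}ᶜ := by
    ext z; simp [errorEvent]
  rw [this]
  exact MeasurableSet.iUnion fun j => (measurableSet_dec_eq c
    (measurable_pi_lambda _ fun i => c.measurable_userOutput h j i m) _ _ _).compl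

/-- A converse from a list decoder: the list contains the true messages unless an error occurs. -/
theorem one_sub_errorProb_mul_log_le (c : Code R n) (h : Fin 3 → ℝ) {V : Type*}
    [MeasurableSpace V] (Q : Measure V) [IsProbabilityMeasure Q]
    {v : Messages R n → (Fin n → ℝ) × (Fin 3 → Fin n → ℝ) → V} (hv : ∀ m, Measurable (v m))
    {ℓ : Messages R n → (Fin n → ℝ) × (Fin 3 → Fin n → ℝ) → ℝ}
    (hℓ : ∀ m, Integrable (ℓ m) (noiseLaw n)) (hℓm : ∀ m, Measurable (ℓ m))
    (hQ : ∀ m, ∀ g : V → ENNReal, Measurable g →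
      ∫⁻ z, g (v m z) * ENNReal.ofReal (Real.exp (-ℓ m z)) ∂noiseLaw n = ∫⁻ y, g y ∂Q)
    {G : V → Set (Messages R n)} (hG : ∀ m, MeasurableSet {y | m ∈ G y})
    (hGv : ∀ m z, (m, z) ∉ c.errorEvent h → m ∈ G (v m z)) {A B : Finset Link}
    (hAB : (∏ p ∈ A, (Fintype.card (Message R n p) : ℝ))
      * ∏ p ∈ B, (Fintype.card (Message R n p) : ℝ) = ∏ p, (Fintype.card (Message R n p) : ℝ))
    (hinj : ∀ y, ∀ m ∈ G y, ∀ m' ∈ G y, (∀ p ∈ A, m p = m' p) → m = m') {b : ℝ}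
    (hb : ∑ m, ∫ z, ℓ m z ∂noiseLaw n ≤ Fintype.card (Messages R n) * b) :
    (1 - c.errorProb h) * ∑ p ∈ B, Real.log (Fintype.card (Message R n p)) ≤ b + 1 := by
  have hpos : ∀ p : Link, (0 : ℝ) < Fintype.card (Message R n p) := fun p => by positivity
  have hcard : (Fintype.card (Messages R n) : ℝ)
      = (∏ p ∈ A, (Fintype.card (Message R n p) : ℝ))
        * ∏ p ∈ B, (Fintype.card (Message R n p) : ℝ) := by
    rw [hAB, Fintype.card_pi, Nat.cast_prod]
  have hN : (0 : ℝ) < Fintype.card (Messages R n) := by positivity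
  have hone : ∀ p : Link, (1 : ℝ) ≤ Fintype.card (Message R n p) := fun p => by
    exact_mod_cast Fintype.card_pos
  have hr : 0 < ∏ p ∈ B, (Fintype.card (Message R n p) : ℝ) :=
    Finset.prod_pos fun p _ => hpos p
  have hmain := sum_measureReal_mul_log_le (noiseLaw n) Q hv hℓ hℓm hQ hG
    (fun y => ncard_le_prod (hinj y)) hr
  rw [Real.log_prod fun p _ => (hpos p).ne'] at hmain
  have hlog : 0 ≤ ∑ p ∈ B, Real.log (Fintype.card (Message R n p)) :=
    Finset.sum_nonneg fun p _ => Real.log_nonneg (hone p)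
  have hsucc : (Fintype.card (Messages R n) : ℝ) * (1 - c.errorProb h)
      ≤ ∑ m, (noiseLaw n).real {z | m ∈ G (v m z)} := by
    rw [errorProb, law_real (c.measurableSet_errorEvent h), mul_sub, ← mul_assoc,
      mul_one_div_cancel hN.ne', mul_one, one_mul, sub_le_iff_le_add, ← Finset.sum_add_distrib]
    have : ∀ m, 1 ≤ (noiseLaw n).real {z | m ∈ G (v m z)}
        + (noiseLaw n).real {z | (m, z) ∈ c.errorEvent h} := by
      intro m
      rw [← probReal_univ (μ := noiseLaw n)]
      refine (measureReal_mono (fun z _ => ?_)).trans (measureReal_union_le _ _)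
      by_cases hz : (m, z) ∈ c.errorEvent h
      · exact Or.inr hz
      · exact Or.inl (hGv m z hz)
    simpa using Finset.sum_le_sum fun m (_ : m ∈ Finset.univ) => this m
  have := (mul_le_mul_of_nonneg_right hsucc hlog).trans (hmain.trans (add_le_add_left hb _))
  -- The guessing term `r * K` is exactly the number of message vectors, so after division it
  -- contributes the constant 1.
  rw [mul_comm (∏ p ∈ B, _), ← hcard] at this
  refine le_of_mul_le_mul_left ?_ hN
  linarith

theorem mean_user_energy_le (c : Code R n) (h : Fin 3 → ℝ) {P Pr : ℝ}
    (hc : c.PowerConstraint h P Pr) (j : Fin 3) :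
    ∑ i, ∑ m, c.enc j (outMessages m j) i ^ 2 ≤ Fintype.card (Messages R n) * (n * P) := by
  have hN : (0 : ℝ) < Fintype.card (Messages R n) := by positivity
  rcases Nat.eq_zero_or_pos n with rfl | hn
  · simp
  have hn' : (0 : ℝ) < n := by exact_mod_cast hn
  have h1 := hc.1 j
  have hint : ∀ i, ∫ ω, c.userInput j i ω ^ 2 ∂law R n
      = (1 / Fintype.card (Messages R n)) * ∑ m, c.enc j (outMessages m j) i ^ 2 := by
    intro i
    rw [integral_law]
    · simp [userInput]
    · exact (Integrable.of_finite (f := fun m : Messages R n =>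
        c.enc j (outMessages m j) i ^ 2)).comp_fst _
  simp_rw [hint] at h1
  rw [← Finset.mul_sum, one_div_mul_eq_div, one_div_mul_eq_div, div_div, div_le_iff₀ (by positivity)]
    at h1
  linarith

theorem mean_relay_energy_le (c : Code R n) (h : Fin 3 → ℝ) {P Pr : ℝ}
    (hc : c.PowerConstraint h P Pr) :
    ∑ i, ∑ m, ∫ z, c.relayInput h i (m, z) ^ 2 ∂noiseLaw n
      ≤ Fintype.card (Messages R n) * (n * Pr) := by
  have hN : (0 : ℝ) < Fintype.card (Messages R n) := by positivity
  rcases Nat.eq_zero_or_pos n with rfl | hn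
  · simp
  have hn' : (0 : ℝ) < n := by exact_mod_cast hn
  have h1 := hc.2.2
  simp_rw [fun i => integral_law (hc.2.1 i)] at h1
  rw [← Finset.mul_sum, one_div_mul_eq_div, one_div_mul_eq_div, div_div, div_le_iff₀ (by positivity)]
    at h1
  linarith

theorem memLp_relayInput (c : Code R n) (h : Fin 3 → ℝ) {P Pr : ℝ}
    (hc : c.PowerConstraint h P Pr) (i : Fin n) (m : Messages R n) :
    MemLp (fun z => c.relayInput h i (m, z)) 2 (noiseLaw n) :=
  (memLp_two_iff_integrable_sq (c.measurable_relayInput h i m).aestronglyMeasurable).2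
    (integrable_law_section (hc.2.1 i) m)

end Code

end YChannel

/-! ### Uplink: bounding the downward messages -/

namespace YChannel

variable {R : RateTuple} {n : ℕ}

theorem integral_relayNoise_gaussLLR (v a : ℝ) (i : Fin n) :
    Integrable (fun z => gaussLLR v a (z.1 i)) (noiseLaw n) ∧
    ∫ z, gaussLLR v a (z.1 i) ∂noiseLaw n
      = (1 / 2) * Real.log v - 1 / 2 + (a ^ 2 + 1) / (2 * v) := by
  have hZ := measurePreserving_relayNoise i
  have hZm := memLp_two_of_measurePreserving hZ
  have hA : MemLp (fun _ : (Fin n → ℝ) × (Fin 3 → Fin n → ℝ) => a) 2 (noiseLaw n) :=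
    memLp_const a
  refine ⟨integrable_gaussLLR v hA hZm, ?_⟩
  rw [integral_gaussLLR v hA hZm (by rw [integral_const_mul, integral_of_measurePreserving hZ,
    mul_zero]) (integral_sq_of_measurePreserving hZ)]
  simp

/-- The variance of a sum of functions of the messages of two distinct users. -/
theorem sum_centered_sq_le {j k : Fin 3} (hjk : j ≠ k) (f : OutMessages R n j → ℝ)
    (g : OutMessages R n k → ℝ) (s t : ℝ) :
    ∑ m : Messages R n,
      (s * (f (outMessages m j) - (∑ m', f (outMessages m' j)) / Fintype.card (Messages R n))
        + t * (g (outMessages m k)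
          - (∑ m', g (outMessages m' k)) / Fintype.card (Messages R n))) ^ 2
      ≤ s ^ 2 * ∑ m, f (outMessages m j) ^ 2 + t ^ 2 * ∑ m, g (outMessages m k) ^ 2 := by
  have hN : (0 : ℝ) < Fintype.card (Messages R n) := by positivity
  have hcov := card_mul_sum_mul hjk f g
  set N : ℝ := ((Fintype.card (Messages R n) : ℕ) : ℝ)
  set F := ∑ m, f (outMessages m j)
  set H := ∑ m, g (outMessages m k)
  have e : ∀ m : Messages R n,
      (s * (f (outMessages m j) - F / N) + t * (g (outMessages m k) - H / N)) ^ 2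
      = s ^ 2 * f (outMessages m j) ^ 2 + t ^ 2 * g (outMessages m k) ^ 2
        + 2 * s * t * (f (outMessages m j) * g (outMessages m k))
        - 2 * s * (s * F / N + t * H / N) * f (outMessages m j)
        - 2 * t * (s * F / N + t * H / N) * g (outMessages m k)
        + (s * F / N + t * H / N) ^ 2 := by
    intro m; ring
  simp_rw [e, Finset.sum_add_distrib, Finset.sum_sub_distrib, Finset.sum_add_distrib,
    ← Finset.mul_sum]
  rw [Finset.sum_const, Finset.card_univ, nsmul_eq_mul]
  -- Distinct users are uncorrelated, so centring removes the cross term and only lowers the energy.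
  have hFH : ∑ m : Messages R n, f (outMessages m j) * g (outMessages m k) = F * H / N := by
    rw [eq_div_iff hN.ne', ← hcov, mul_comm]
  change _ + 2 * s * t * (∑ m : Messages R n, f (outMessages m j) * g (outMessages m k))
    - _ * F - _ * H + N * _ ≤ _
  rw [hFH]
  have : N * (s * F / N + t * H / N) ^ 2 = (s * F + t * H) ^ 2 / N := by
    field_simp
  rw [this]
  have h1 : 0 ≤ (s * F) ^ 2 / N := by positivity
  have h2 : 0 ≤ (t * H) ^ 2 / N := by positivity
  have h3 : 2 * s * t * (F * H / N) - 2 * s * (s * F / N + t * H / N) * F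
      - 2 * t * (s * F / N + t * H / N) * H + (s * F + t * H) ^ 2 / N
      = -((s * F) ^ 2 / N) - (t * H) ^ 2 / N := by
    field_simp; ring
  linarith

namespace Code

/-- The genie bound for the uplink: a receiver which knows the relay output, the noises of the
users and the messages on the upward links recovers the messages on the downward links. -/
theorem downLinks_bound (c : Code R n) (h : Fin 3 → ℝ) {P Pr : ℝ} (hP : 0 ≤ P)
    (hc : c.PowerConstraint h P Pr) :
    (1 - c.errorProb h) * ∑ p ∈ downLinks, Real.log (Fintype.card (Message R n p))
      ≤ n * ((1 / 2) * Real.log (1 + (h 1 ^ 2 * P + h 2 ^ 2 * P))) + 1 := by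
  have hN : (0 : ℝ) < Fintype.card (Messages R n) := by positivity
  have hS : 0 ≤ h 1 ^ 2 * P + h 2 ^ 2 * P := by positivity
  obtain ⟨v, hv⟩ : ∃ v : ℝ≥0, (v : ℝ) = 1 + (h 1 ^ 2 * P + h 2 ^ 2 * P) :=
    ⟨⟨_, by linarith⟩, rfl⟩
  have hvpos : (0 : ℝ) < v := by linarith
  have hv0 : v ≠ 0 := by rintro rfl; simp at hvpos
  -- `μ` is the mean codeword. The relay receives `a + b + noise`: `a` is the centred signal of
  -- users 1 and 2, while `b` depends on the messages of user 0 only and is thus known to the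
  -- receiver. Without centring, nonzero means would leave a cross term in the energy.
  let μ : Fin 3 → Fin n → ℝ := fun j i =>
    (∑ m', c.enc j (outMessages m' j) i) / Fintype.card (Messages R n)
  let a : Messages R n → Fin n → ℝ := fun m i =>
    h 1 * (c.enc 1 (outMessages m 1) i - μ 1 i) + h 2 * (c.enc 2 (outMessages m 2) i - μ 2 i)
  let b : Messages R n → Fin n → ℝ := fun m i =>
    h 0 * c.enc 0 (outMessages m 0) i + h 1 * μ 1 i + h 2 * μ 2 i
  -- The words the users would receive, recomputed from the observation `y` by rerunning the relay
  -- under the candidate messages.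
  let w : Messages R n → (Fin n → ℝ) × (Fin 3 → Fin n → ℝ) → (j : Fin 3) → Fin n → ℝ :=
    fun m y j i => h j * c.relay i (fun t => b m (Fin.castLE i.isLt.le t)
      + y.1 (Fin.castLE i.isLt.le t)) + y.2 j i
  have hw : ∀ m j, Measurable fun y => w m y j := by
    intro m j
    refine measurable_pi_lambda _ fun i => ?_
    have := (c.measurable_relay i).comp (measurable_pi_lambda
      (fun (y : (Fin n → ℝ) × (Fin 3 → Fin n → ℝ)) t => b m (Fin.castLE i.isLt.le t)
        + y.1 (Fin.castLE i.isLt.le t)) fun t => by fun_prop)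
    exact (this.const_mul (h j)).add (by fun_prop)
  have hwout : ∀ m z j, w m (a m + z.1, z.2) j = fun i => c.userOutput h j i (m, z) := by
    intro m z j
    funext i
    have : (fun t => b m (Fin.castLE i.isLt.le t) + (a m + z.1) (Fin.castLE i.isLt.le t))
        = fun t => c.relayOutput h (Fin.castLE i.isLt.le t) (m, z) := by
      funext t
      simp only [relayOutput, userInput, Fin.sum_univ_three, Pi.add_apply, a, b]
      ring
    simp only [w, userOutput, relayInput, this]
  have hLLR := fun m i => integral_relayNoise_gaussLLR v (a m i) i
  refine c.one_sub_errorProb_mul_log_le h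
    (Q := (gaussVec n v).prod (Measure.pi fun _ : Fin 3 => gaussVec n 1))
    (v := fun m z => (a m + z.1, z.2)) (fun m => by fun_prop)
    (ℓ := fun m z => ∑ i, gaussLLR v (a m i) (z.1 i))
    (fun m => integrable_finsetSum _ fun i _ => (hLLR m i).1)
    (fun m => Finset.measurable_fun_sum _ fun i _ =>
      (measurable_gaussLLR _ _).comp (by fun_prop))
    (fun m g hg => ?_)
    (G := fun y => {m | ∀ j, c.dec j (w m y j) (outMessages m j) = inMessages m j})
    (fun m => ?_) (fun m z hz j => ?_) (prod_upLinks_mul_prod_downLinks _) (fun y m hm m' hm' hA => ?_)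
    ?_
  · have hmLLR : ∀ i, Measurable fun z : (Fin n → ℝ) × (Fin 3 → Fin n → ℝ) =>
        gaussLLR v (a m i) (z.1 i) := fun i => (measurable_gaussLLR _ _).comp (by fun_prop)
    -- Only the relay noise is tilted, so it is integrated first with the user noises held fixed.
    rw [lintegral_prod_symm _ (by fun_prop), lintegral_prod_symm _ (by fun_prop)]
    exact lintegral_congr fun y => lintegral_gaussVec_gaussLLR hv0 (a m)
      (g := fun x => g (x, y)) (by fun_prop)
  · have : {y | m ∈ {m | ∀ j, c.dec j (w m y j) (outMessages m j) = inMessages m j}}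
        = ⋂ j, {y | c.dec j (w m y j) (outMessages m j) = inMessages m j} := by
      ext y; simp
    rw [this]
    exact MeasurableSet.iInter fun j => measurableSet_dec_eq c (hw m j) _ _ _
  · rw [hwout]
    by_contra hne
    exact hz ⟨j, hne⟩
  -- All messages of user 0 are upward, hence shared; they fix the reconstructed words, so user 0's
  -- decoder yields the messages sent to user 0. One of these completes the outgoing messages of
  -- user 1, whose decoder gives the last missing one.
  · have hup : ∀ j k (hjk : j < k), m ⟨(j, k), hjk.ne⟩ = m' ⟨(j, k), hjk.ne⟩ :=
      fun j k hjk => hA _ (by simpa [upLinks] using hjk)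
    have o0 : outMessages m 0 = outMessages m' 0 :=
      outMessages_congr fun k hk => hup 0 k (Fin.pos_of_ne_zero hk.symm)
    have hww : ∀ j, w m y j = w m' y j := by
      intro j; simp only [w, b, o0]
    have i0 : inMessages m 0 = inMessages m' 0 := by rw [← hm 0, ← hm' 0, o0, hww]
    have o1 : outMessages m 1 = outMessages m' 1 := outMessages_congr fun k hk => by
      fin_cases k
      · exact inMessages_eq i0 1 hk
      · exact absurd rfl hk
      · exact hup 1 2 (by decide)
    have i1 : inMessages m 1 = inMessages m' 1 := by rw [← hm 1, ← hm' 1, o1, hww]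
    exact messages_ext (hup 0 1 (by decide)) (hup 0 2 (by decide)) (inMessages_eq i0 1 _)
      (hup 1 2 (by decide)) (inMessages_eq i0 2 _) (inMessages_eq i1 2 _)
  · have hE : ∑ i, ∑ m, a m i ^ 2
        ≤ Fintype.card (Messages R n) * (n * (h 1 ^ 2 * P + h 2 ^ 2 * P)) := by
      calc ∑ i, ∑ m, a m i ^ 2
          ≤ ∑ i, (h 1 ^ 2 * ∑ m, c.enc 1 (outMessages m 1) i ^ 2
              + h 2 ^ 2 * ∑ m, c.enc 2 (outMessages m 2) i ^ 2) :=
            Finset.sum_le_sum fun i _ => sum_centered_sq_le (by decide)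
              (fun o => c.enc 1 o i) (fun o => c.enc 2 o i) (h 1) (h 2)
        _ ≤ h 1 ^ 2 * (Fintype.card (Messages R n) * (n * P))
              + h 2 ^ 2 * (Fintype.card (Messages R n) * (n * P)) := by
            rw [Finset.sum_add_distrib, ← Finset.mul_sum, ← Finset.mul_sum]
            gcongr
            · exact c.mean_user_energy_le h hc 1
            · exact c.mean_user_energy_le h hc 2
        _ = _ := by ring
    simp_rw [integral_finsetSum _ fun i _ => (hLLR _ i).1, (hLLR _ _).2]
    rw [Finset.sum_comm]
    simp_rw [add_div, Finset.sum_add_distrib, ← Finset.sum_div]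
    simp only [Finset.sum_const, Finset.card_univ, nsmul_eq_mul, Fintype.card_fin]
    rw [← hv]
    -- `v` was chosen as one plus the allowed signal energy, so `(v - 1)/(2v) + 1/(2v)` cancels the
    -- `-1/2` and leaves `(1/2) log v` per symbol.
    have h1 : (∑ i, ∑ m, a m i ^ 2) / (2 * v)
        ≤ Fintype.card (Messages R n) * (n * ((v : ℝ) - 1)) / (2 * v) := by
      gcongr
      calc _ ≤ _ := hE
        _ = _ := by rw [hv]; ring
    calc _ ≤ (n : ℝ) * (Fintype.card (Messages R n) * (1 / 2 * Real.log v - 1 / 2))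
          + (Fintype.card (Messages R n) * (n * ((v : ℝ) - 1)) / (2 * v)
            + n * (Fintype.card (Messages R n) * (1 / (2 * v)))) := by
          simp only [mul_div_assoc] at h1 ⊢
          simp only [mul_one_div] at h1 ⊢
          linarith
      _ = _ := by field_simp; ring

end Code

end YChannel

/-! ### Downlink: bounding the upward messages -/

namespace YChannel

variable {R : RateTuple} {n : ℕ}

theorem integral_userNoise_gaussLLR (v s : ℝ) {X : (Fin n → ℝ) → ℝ}
    (hX : MemLp (fun z => X z.1) 2 (noiseLaw n)) (j : Fin 3) (i : Fin n) :
    Integrable (fun z => gaussLLR v (s * X z.1) (z.2 j i)) (noiseLaw n) ∧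
    ∫ z, gaussLLR v (s * X z.1) (z.2 j i) ∂noiseLaw n
      = (1 / 2) * Real.log v - 1 / 2
        + (s ^ 2 * ∫ z, X z.1 ^ 2 ∂noiseLaw n + 1) / (2 * v) := by
  have hZ := measurePreserving_userNoise j i
  have hZm := memLp_two_of_measurePreserving hZ
  have hA := hX.const_mul s
  refine ⟨integrable_gaussLLR v hA hZm, ?_⟩
  rw [integral_gaussLLR v hA hZm (integral_relay_mul_userNoise (fun x => s * X x) j i)
    (integral_sq_of_measurePreserving hZ), ← integral_const_mul]
  simp_rw [mul_pow]

theorem integral_two_userNoise_gaussLLR (v s κ : ℝ) {X : (Fin n → ℝ) → ℝ}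
    (hX : MemLp (fun z => X z.1) 2 (noiseLaw n)) {j k : Fin 3} (hjk : j ≠ k) (i : Fin n) :
    Integrable (fun z => gaussLLR v (s * X z.1 - κ * z.2 j i) (z.2 k i)) (noiseLaw n) ∧
    ∫ z, gaussLLR v (s * X z.1 - κ * z.2 j i) (z.2 k i) ∂noiseLaw n
      = (1 / 2) * Real.log v - 1 / 2
        + (s ^ 2 * ∫ z, X z.1 ^ 2 ∂noiseLaw n + κ ^ 2 + 1) / (2 * v) := by
  have hj := measurePreserving_userNoise j i
  have hk := measurePreserving_userNoise k i
  have hjm := memLp_two_of_measurePreserving hj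
  have hkm := memLp_two_of_measurePreserving hk
  have hA : MemLp (fun z => s * X z.1 - κ * z.2 j i) 2 (noiseLaw n) :=
    (hX.const_mul s).sub (hjm.const_mul κ)
  have hXj : Integrable (fun z => X z.1 * z.2 j i) (noiseLaw n) := hX.integrable_mul hjm
  have hXk : Integrable (fun z => X z.1 * z.2 k i) (noiseLaw n) := hX.integrable_mul hkm
  have hjk' : Integrable (fun z => z.2 j i * z.2 k i) (noiseLaw n) := hjm.integrable_mul hkm
  refine ⟨integrable_gaussLLR v hA hkm, ?_⟩
  have h1 : ∫ z, (s * X z.1 - κ * z.2 j i) * z.2 k i ∂noiseLaw n = 0 := by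
    have e : ∀ z : (Fin n → ℝ) × (Fin 3 → Fin n → ℝ), (s * X z.1 - κ * z.2 j i) * z.2 k i
        = s * (X z.1 * z.2 k i) - κ * (z.2 j i * z.2 k i) := fun z => by ring
    simp_rw [e]
    rw [integral_sub (hXk.const_mul s) (hjk'.const_mul κ), integral_const_mul,
      integral_const_mul, integral_relay_mul_userNoise, integral_userNoise_mul_userNoise hjk]
    simp
  have h2 : ∫ z, (s * X z.1 - κ * z.2 j i) ^ 2 ∂noiseLaw n
      = s ^ 2 * ∫ z, X z.1 ^ 2 ∂noiseLaw n + κ ^ 2 := by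
    have e : ∀ z : (Fin n → ℝ) × (Fin 3 → Fin n → ℝ), (s * X z.1 - κ * z.2 j i) ^ 2
        = s ^ 2 * X z.1 ^ 2 + (κ ^ 2 * z.2 j i ^ 2 - 2 * s * κ * (X z.1 * z.2 j i)) :=
      fun z => by ring
    simp_rw [e]
    have i1 := hjm.integrable_sq.const_mul (κ ^ 2)
    have i2 := hXj.const_mul (2 * s * κ)
    have i12 : Integrable (fun z => κ ^ 2 * z.2 j i ^ 2 - 2 * s * κ * (X z.1 * z.2 j i))
      (noiseLaw n) := i1.sub i2
    rw [integral_add (hX.integrable_sq.const_mul (s ^ 2)) i12,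
      integral_sub i1 i2, integral_const_mul, integral_const_mul, integral_const_mul,
      integral_relay_mul_userNoise, integral_sq_of_measurePreserving hj]
    ring
  rw [integral_gaussLLR v hA hkm h1 (integral_sq_of_measurePreserving hk), h2]

/-- Change of measure for two observations of a common signal, the second of which is predicted
linearly from the first. -/
theorem lintegral_two_users_gaussLLR {v τ : ℝ≥0} (hv : v ≠ 0) (hτ : τ ≠ 0) (s t κ : ℝ)
    {X : (Fin n → ℝ) → Fin n → ℝ} (hX : Measurable X)
    {g : (Fin n → ℝ) × (Fin n → ℝ) → ENNReal} (hg : Measurable g) :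
    ∫⁻ z, g (s • X z.1 + z.2 1, (t • X z.1 - κ • z.2 1) + z.2 2)
        * ENNReal.ofReal (Real.exp (-(∑ i, gaussLLR v (s * X z.1 i) (z.2 1 i)
          + ∑ i, gaussLLR τ (t * X z.1 i - κ * z.2 1 i) (z.2 2 i)))) ∂noiseLaw n
      = ∫⁻ y, g y ∂(gaussVec n v).prod (gaussVec n τ) := by
  have hX' : ∀ i, Measurable fun x => X x i := fun i => (measurable_pi_apply i).comp hX
  rw [lintegral_noiseLaw_two_users (f := fun x z₁ z₂ => g (s • X x + z₁, (t • X x - κ • z₁) + z₂)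
        * ENNReal.ofReal (Real.exp (-(∑ i, gaussLLR v (s * X x i) (z₁ i)
          + ∑ i, gaussLLR τ (t * X x i - κ * z₁ i) (z₂ i)))))
      (by unfold gaussLLR; fun_prop), lintegral_prod _ hg.aemeasurable]
  -- For fixed relay noise and `z₁`, the second observation is a known shift plus `z₂`. Removing
  -- `z₂` first leaves a one-user change of measure in `z₁`: a chain rule for likelihood ratios.
  have hin : ∀ x z₁, ∫⁻ z₂, g (s • X x + z₁, (t • X x - κ • z₁) + z₂)
        * ENNReal.ofReal (Real.exp (-(∑ i, gaussLLR v (s * X x i) (z₁ i)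
          + ∑ i, gaussLLR τ (t * X x i - κ * z₁ i) (z₂ i)))) ∂gaussVec n 1
      = (∫⁻ w, g (s • X x + z₁, w) ∂gaussVec n τ)
        * ENNReal.ofReal (Real.exp (-∑ i, gaussLLR v (s * X x i) (z₁ i))) := by
    intro x z₁
    rw [← lintegral_gaussVec_gaussLLR hτ (t • X x - κ • z₁)
      (g := fun w => g (s • X x + z₁, w)) (by fun_prop), ← lintegral_mul_const _
      (by unfold gaussLLR; fun_prop)]
    refine lintegral_congr fun z₂ => ?_
    rw [neg_add, Real.exp_add, ENNReal.ofReal_mul (Real.exp_pos _).le]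
    simp only [Pi.sub_apply, Pi.smul_apply, smul_eq_mul]
    ring
  simp_rw [hin]
  have hout : ∀ x, ∫⁻ z₁, (∫⁻ w, g (s • X x + z₁, w) ∂gaussVec n τ)
        * ENNReal.ofReal (Real.exp (-∑ i, gaussLLR v (s * X x i) (z₁ i))) ∂gaussVec n 1
      = ∫⁻ y, ∫⁻ w, g (y, w) ∂gaussVec n τ ∂gaussVec n v := fun x =>
    lintegral_gaussVec_gaussLLR hv (s • X x) (g := fun y => ∫⁻ w, g (y, w) ∂gaussVec n τ)
      hg.lintegral_prod_right'
  simp_rw [hout]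
  simp

namespace Code

/-- The genie bound for the downlink: a receiver which knows the outputs of the two weaker users
and the messages on the downward links recovers the messages on the upward links. -/
theorem upLinks_bound (c : Code R n) (h : Fin 3 → ℝ) {P Pr : ℝ} (hP : 0 ≤ Pr)
    (hc : c.PowerConstraint h P Pr) :
    (1 - c.errorProb h) * ∑ p ∈ upLinks, Real.log (Fintype.card (Message R n p))
      ≤ n * ((1 / 2) * Real.log (1 + (h 1 ^ 2 * Pr + h 2 ^ 2 * Pr))) + 1 := by
  have hN : (0 : ℝ) < Fintype.card (Messages R n) := by positivity
  -- For a centred Gaussian relay symbol of variance `Pr`, `v` is the variance of user 1's output,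
  -- `κ` the coefficient of the best linear prediction of user 2's output from it, and `τ` the
  -- variance of the prediction error. Uncorrelated Gaussian errors allow a product reference law.
  obtain ⟨v, hv⟩ : ∃ v : ℝ≥0, (v : ℝ) = 1 + h 1 ^ 2 * Pr := ⟨⟨_, by positivity⟩, rfl⟩
  have hvpos : (0 : ℝ) < v := by rw [hv]; positivity
  have hv0 : v ≠ 0 := by rintro rfl; simp at hvpos
  obtain ⟨τ, hτ⟩ : ∃ τ : ℝ≥0, (τ : ℝ) = (1 + (h 1 ^ 2 * Pr + h 2 ^ 2 * Pr)) / v :=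
    ⟨⟨_, by positivity⟩, rfl⟩
  have hτpos : (0 : ℝ) < τ := by rw [hτ]; positivity
  have hτ0 : τ ≠ 0 := by rintro rfl; simp at hτpos
  obtain ⟨κ, hκ⟩ : ∃ κ : ℝ, κ = h 1 * h 2 * Pr / v := ⟨_, rfl⟩
  -- The relay symbol ignores the user noises, so these may be set to zero; this exhibits it as a
  -- function of the relay noise alone.
  let X : Messages R n → (Fin n → ℝ) → Fin n → ℝ := fun m x i => c.relayInput h i (m, (x, 0))
  have hXm : ∀ m, Measurable (X m) := fun m => measurable_pi_lambda _ fun i =>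
    (c.measurable_relayInput h i m).comp (by fun_prop)
  have hX : ∀ m z i, X m z.1 i = c.relayInput h i (m, z) := fun m z i => rfl
  have hXL : ∀ m i, MemLp (fun z => X m z.1 i) 2 (noiseLaw n) :=
    fun m i => c.memLp_relayInput h hc i m
  have hL1 := fun m i => integral_userNoise_gaussLLR v (h 1) (X := fun x => X m x i) (hXL m i) 1 i
  have hL2 := fun m i => integral_two_userNoise_gaussLLR τ (h 2 - κ * h 1) κ
    (X := fun x => X m x i) (hXL m i)
    (show (1 : Fin 3) ≠ 2 by decide) i
  have hXi : ∀ m i, Measurable fun z : (Fin n → ℝ) × (Fin 3 → Fin n → ℝ) => X m z.1 i :=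
    fun m i => c.measurable_relayInput h i m
  refine c.one_sub_errorProb_mul_log_le h (Q := (gaussVec n v).prod (gaussVec n τ))
    (v := fun m z => (h 1 • X m z.1 + z.2 1, ((h 2 - κ * h 1) • X m z.1 - κ • z.2 1) + z.2 2))
    (fun m => by have := hXm m; fun_prop)
    (ℓ := fun m z => ∑ i, gaussLLR v (h 1 * X m z.1 i) (z.2 1 i)
      + ∑ i, gaussLLR τ ((h 2 - κ * h 1) * X m z.1 i - κ * z.2 1 i) (z.2 2 i))
    (fun m => (integrable_finsetSum _ fun i _ => (hL1 m i).1).add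
      (integrable_finsetSum _ fun i _ => (hL2 m i).1))
    (fun m => by have := hXi m; unfold gaussLLR; fun_prop)
    (fun m g hg => lintegral_two_users_gaussLLR hv0 hτ0 _ _ _ (hXm m) hg)
    (G := fun y => {m | c.dec 1 y.1 (outMessages m 1) = inMessages m 1 ∧
      c.dec 2 (κ • y.1 + y.2) (outMessages m 2) = inMessages m 2})
    (fun m => ?_) (fun m z hz => ?_) (A := downLinks)
    (by rw [mul_comm]; exact prod_upLinks_mul_prod_downLinks _) (fun y m hm m' hm' hA => ?_) ?_
  · exact (measurableSet_dec_eq c (by fun_prop) 1 _ _).inter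
      (measurableSet_dec_eq c (by fun_prop) 2 _ _)
  · have hdec : ∀ j, c.dec j (fun i => c.userOutput h j i (m, z)) (outMessages m j)
        = inMessages m j := by
      intro j
      by_contra hne
      exact hz ⟨j, hne⟩
    have e1 : h 1 • X m z.1 + z.2 1 = fun i => c.userOutput h 1 i (m, z) := rfl
    -- Adding the prediction back to the prediction error restores user 2's output.
    have e2 : κ • (h 1 • X m z.1 + z.2 1) + (((h 2 - κ * h 1) • X m z.1 - κ • z.2 1) + z.2 2)
        = fun i => c.userOutput h 2 i (m, z) := by
      funext i
      simp only [Pi.add_apply, Pi.sub_apply, Pi.smul_apply, smul_eq_mul, hX, userOutput]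
      ring
    refine ⟨?_, ?_⟩
    · rw [e1]; exact hdec 1
    · rw [e2]; exact hdec 2
  -- All messages of user 2 are downward, hence shared, so its decoder yields the messages sent to
  -- it. One of these completes the outgoing messages of user 1, whose decoder gives the last
  -- missing upward one.
  · have hdn : ∀ j k (hjk : k < j), m ⟨(j, k), hjk.ne'⟩ = m' ⟨(j, k), hjk.ne'⟩ :=
      fun j k hjk => hA _ (by simpa [downLinks] using hjk)
    have o2 : outMessages m 2 = outMessages m' 2 := outMessages_congr fun k hk =>
      hdn 2 k (lt_of_le_of_ne (Fin.le_last k) hk.symm)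
    have i2 : inMessages m 2 = inMessages m' 2 := by rw [← hm.2, ← hm'.2, o2]
    have o1 : outMessages m 1 = outMessages m' 1 := outMessages_congr fun k hk => by
      fin_cases k
      · exact hdn 1 0 (by decide)
      · exact absurd rfl hk
      · exact inMessages_eq i2 1 hk
    have i1 : inMessages m 1 = inMessages m' 1 := by rw [← hm.1, ← hm'.1, o1]
    exact messages_ext (inMessages_eq i1 0 _) (inMessages_eq i2 0 _) (hdn 1 0 (by decide))
      (inMessages_eq i2 1 _) (hdn 2 0 (by decide)) (hdn 2 1 (by decide))
  · have hE : ∑ m, ∑ i, ∫ z, X m z.1 i ^ 2 ∂noiseLaw n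
        ≤ Fintype.card (Messages R n) * (n * Pr) := by
      rw [Finset.sum_comm]
      exact c.mean_relay_energy_le h hc
    have hint : ∀ m, ∫ z, (∑ i, gaussLLR v (h 1 * X m z.1 i) (z.2 1 i)
          + ∑ i, gaussLLR τ ((h 2 - κ * h 1) * X m z.1 i - κ * z.2 1 i) (z.2 2 i)) ∂noiseLaw n
        = n * ((1 / 2) * Real.log v - 1 / 2 + 1 / (2 * v)
            + ((1 / 2) * Real.log τ - 1 / 2 + (κ ^ 2 + 1) / (2 * τ)))
          + (h 1 ^ 2 / (2 * v) + (h 2 - κ * h 1) ^ 2 / (2 * τ))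
            * ∑ i, ∫ z, X m z.1 i ^ 2 ∂noiseLaw n := by
      intro m
      rw [integral_add (integrable_finsetSum _ fun i _ => (hL1 m i).1)
        (integrable_finsetSum _ fun i _ => (hL2 m i).1),
        integral_finsetSum _ fun i _ => (hL1 m i).1, integral_finsetSum _ fun i _ => (hL2 m i).1,
        ← Finset.sum_add_distrib, Finset.mul_sum]
      simp_rw [fun i => (hL1 m i).2, fun i => (hL2 m i).2]
      have hconst : ∀ C : ℝ, (n : ℝ) * C = ∑ _i : Fin n, C := fun C => by simp
      rw [hconst, ← Finset.sum_add_distrib]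
      exact Finset.sum_congr rfl fun i _ => by ring
    simp_rw [hint]
    rw [Finset.sum_add_distrib, ← Finset.mul_sum, ← Finset.mul_sum, Finset.sum_const,
      Finset.card_univ, nsmul_eq_mul]
    -- `v * τ` is the determinant of the covariance matrix of the two outputs.
    have hlog : Real.log v + Real.log τ = Real.log (1 + (h 1 ^ 2 * Pr + h 2 ^ 2 * Pr)) := by
      rw [← Real.log_mul hvpos.ne' hτpos.ne', hτ, mul_div_cancel₀ _ hvpos.ne']
    have h1 : (1 + h 1 ^ 2 * Pr) / (2 * v) = 1 / 2 := by
      rw [← hv]; field_simp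
    have h2 : ((h 2 - κ * h 1) ^ 2 * Pr + κ ^ 2 + 1) / (2 * τ) = 1 / 2 := by
      have : (h 2 - κ * h 1) ^ 2 * Pr + κ ^ 2 + 1 = τ := by
        rw [hτ, hκ]
        field_simp
        rw [hv]
        ring
      rw [this]; field_simp
    refine (add_le_add_right (mul_le_mul_of_nonneg_left hE (by positivity)) _).trans (le_of_eq ?_)
    rw [← hlog]
    linear_combination (Fintype.card (Messages R n) * n : ℝ) * (h1 + h2)

end Code

end YChannel

/-! ### Passage to the limit and comparison of the bounds -/

namespace YChannel

/-- Rounding down a number that is at least 1 loses at most a factor 2, that is, one bit per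
message. -/
theorem log_card_message_ge (R : RateTuple) (n : ℕ) (p : Link) :
    ((n : ℝ) * R p - 1) * Real.log 2 ≤ Real.log (Fintype.card (Message R n p)) := by
  have h1 := one_le_two_rpow R n p
  set x : ℝ := (2 : ℝ) ^ ((n : ℝ) * (R p : ℝ)) with hx
  have h2 : x / 2 ≤ ⌊x⌋₊ := by
    have h3 : (1 : ℝ) ≤ ⌊x⌋₊ := by exact_mod_cast Nat.floor_pos.2 h1
    linarith [Nat.lt_floor_add_one x]
  rw [Fintype.card_fin]
  refine le_trans (le_of_eq ?_) (Real.log_le_log (by positivity) h2)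
  rw [Real.log_div (by positivity) two_ne_zero, hx, Real.log_rpow two_pos]
  ring

/-- The converse: every achievable sum rate is at most `2 C(h₂² P + h₃² P)`. -/
theorem Achievable.sumRate_le {h : Fin 3 → ℝ} {P : ℝ} (hP : 0 ≤ P) {R : RateTuple}
    (hR : Achievable h P P R) : sumRate R ≤ 2 * gaussC (h 1 ^ 2 * P + h 2 ^ 2 * P) := by
  obtain ⟨c, hc, herr⟩ := hR
  set S := h 1 ^ 2 * P + h 2 ^ 2 * P with hS
  have hlog2 : 0 < Real.log 2 := Real.log_pos one_lt_two
  -- The 6 collects one rounding bit from each link and the 2 one guessing constant from each genie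
  -- bound; both vanish after division by `n`.
  have hbound : ∀ n : ℕ, (1 - (c n).errorProb h) * ((n * sumRate R - 6) * Real.log 2)
      ≤ n * Real.log (1 + S) + 2 := by
    intro n
    have h1 := (c n).downLinks_bound h hP (hc n)
    have h2 := (c n).upLinks_bound h hP (hc n)
    rw [← hS] at h1 h2
    have hle : (n * sumRate R - 6) * Real.log 2
        ≤ ∑ p ∈ upLinks, Real.log (Fintype.card (Message R n p))
          + ∑ p ∈ downLinks, Real.log (Fintype.card (Message R n p)) := by
      rw [sum_upLinks_add_sum_downLinks fun p => Real.log (Fintype.card (Message R n p))]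
      refine le_trans (le_of_eq ?_) (Finset.sum_le_sum fun p _ => log_card_message_ge R n p)
      rw [← Finset.sum_mul, Finset.sum_sub_distrib, ← Finset.mul_sum, sumRate]
      have : Fintype.card Link = 6 := by decide
      simp [this]
    have hε : 0 ≤ 1 - (c n).errorProb h := sub_nonneg.2 measureReal_le_one
    have := mul_le_mul_of_nonneg_left hle hε
    linarith
  have hlim0 : Tendsto (fun n : ℕ => (1 : ℝ) / n) atTop (𝓝 0) := tendsto_one_div_atTop_nhds_zero_nat
  have hL : Tendsto (fun n : ℕ => (1 - (c n).errorProb h)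
      * ((sumRate R - 6 * (1 / n)) * Real.log 2)) atTop (𝓝 (sumRate R * Real.log 2)) := by
    have := (herr.const_sub 1).mul (((hlim0.const_mul 6).const_sub (sumRate R)).mul_const
      (Real.log 2))
    simpa using this
  have hU : Tendsto (fun n : ℕ => Real.log (1 + S) + 2 * (1 / (n : ℝ))) atTop
      (𝓝 (Real.log (1 + S))) := by
    simpa using (hlim0.const_mul 2).const_add (Real.log (1 + S))
  have hfin : sumRate R * Real.log 2 ≤ Real.log (1 + S) := by
    refine le_of_tendsto_of_tendsto hL hU ?_
    filter_upwards [eventually_gt_atTop 0] with n hn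
    have hn' : (0 : ℝ) < n := by exact_mod_cast hn
    refine le_of_mul_le_mul_left ?_ hn'
    calc (n : ℝ) * ((1 - (c n).errorProb h) * ((sumRate R - 6 * (1 / n)) * Real.log 2))
        = (1 - (c n).errorProb h) * ((n * sumRate R - 6) * Real.log 2) := by field_simp
      _ ≤ n * Real.log (1 + S) + 2 := hbound n
      _ = n * (Real.log (1 + S) + 2 * (1 / (n : ℝ))) := by field_simp
  rw [gaussC, Real.logb]
  calc sumRate R ≤ Real.log (1 + S) / Real.log 2 := (le_div_iff₀ hlog2).2 hfin
    _ = _ := by ring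

theorem gaussC_le_gaussC {x y : ℝ} (hx : 0 ≤ x) (hxy : x ≤ y) : gaussC x ≤ gaussC y := by
  unfold gaussC
  gcongr
  · norm_num

end YChannel

theorem mainTheorem5 (h : Fin 3 → ℝ) (h01 : h 1 ^ 2 ≤ h 0 ^ 2) (h12 : h 2 ^ 2 ≤ h 1 ^ 2)
    (P Pr : ℝ) (hP : 0 ≤ P) (hPr : P = Pr) :
    YChannel.sumCapacity h P Pr ≤
        ((2 * YChannel.gaussC (h 1 ^ 2 * P + h 2 ^ 2 * P) : ℝ) : EReal) ∧
      2 * YChannel.gaussC (h 1 ^ 2 * P + h 2 ^ 2 * P) ≤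
        YChannel.gaussC (h 1 ^ 2 * P + h 2 ^ 2 * P) +
          YChannel.gaussC (min (h 0 ^ 2 * P + h 2 ^ 2 * P) ((|h 1| + |h 2|) ^ 2 * P)) := by
  subst hPr
  refine ⟨iSup₂_le fun R hR => EReal.coe_le_coe_iff.2 (YChannel.Achievable.sumRate_le hP hR), ?_⟩
  rw [two_mul]
  -- By monotonicity of `C`, it remains to compare with each entry of the minimum: the first uses
  -- the ordering of the gains, the second that the square of a sum of absolute values dominates the
  -- sum of squares.
  refine add_le_add_right (YChannel.gaussC_le_gaussC (by positivity) (le_min (by gcongr) ?_)) _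
  rw [← add_mul]
  refine mul_le_mul_of_nonneg_right ?_ hP
  have h3 : 0 ≤ |h 1| * |h 2| := by positivity
  rw [← sq_abs (h 1), ← sq_abs (h 2)]
  linarith [add_sq |h 1| |h 2|]
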